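/- Graphs are simple and may be finite or infinite, of any cardinality. A partition of a set $X$ is a function $\pi : X \to \{0,1\}$. Given a partition $\pi$ of the vertex set $V(G)$ of a graph $G$, a vertex $x$ is happy in $\pi$ if the number of its neighbours $y$ with $\pi(y) \neq \pi(x)$ is at least the number of its neighbours $y$ with $\pi(y) = \pi(x)$, as cardinals. The partition $\pi$ is unfriendly if every vertex of $G$ is happy in $\pi$. The graph $G$ is pre-partitionable if for every $U \subseteq V(G)$ and every partition $\pi$ of $U$ there is a partition $\pi'$ of $V(G)$ that extends $\pi$ such that every vertex in $V(G) \setminus U$ is happy in $\pi'$. Let $\mathcal W$ be the class of all countable (possibly finite) graphs $G$ such that only finitely many vertices of infinite degree in $G$ have only finitely many neighbours of infinite degree. Define classes $\mathcal W(\mu)$ by recursion on the ordinal $\mu$: put $\mathcal W(0) := \mathcal W$, and for $\mu > 0$ let $\mathcal W(\mu)$ be the class of all graphs $G$ that have a finite vertex set $S$ such that for every component $C$ of $G - S$ there is an ordinal $\lambda < \mu$ with $C \in \mathcal W(\lambda)$. The closure $\overline{\mathcal W}$ of $\mathcal W$ is the union of the classes $\mathcal W(\mu)$ over all ordinals $\mu$.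 Theorem. Every graph in $\overline{\mathcal W}$ is pre-partitionable. In particular, every graph in $\overline{\mathcal W}$ has an unfriendly partition. -/

import Mathlib

universe u

namespace UnfriendlyPartition

/-! ### Partitions of graphs -/

section Partitions

variable {V : Type u} (G : SimpleGraph V)

/-- The friends of `x` in the partition `π`: the neighbours of `x` in the same class. -/
def friends (π : V → Bool) (x : V) : Set V := {y | G.Adj x y ∧ π y = π x}

/-- The opponents of `x` in the partition `π`: the neighbours of `x` in the other class. -/
def opponents (π : V → Bool) (x : V) : Set V := {y | G.Adj x y ∧ π y ≠ π x}

/-- A vertex is happy if it has at least as many opponents as friends, where the numbers of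
opponents and friends are compared as (possibly infinite) cardinals. -/
def Happy (π : V → Bool) (x : V) : Prop :=
  Cardinal.mk (friends G π x) ≤ Cardinal.mk (opponents G π x)

/-- A partition of `G` is unfriendly if every vertex is happy in it. -/
def Unfriendly (π : V → Bool) : Prop := ∀ x, Happy G π x

/-- `G` is pre-partitionable if every partition `π` of any vertex set `U` extends to a partition
of `G` in which every vertex outside `U` is happy. -/
def PrePartitionable : Prop :=
  ∀ (U : Set V) (π : U → Bool), ∃ π' : V → Bool,
    (∀ u : U, π' u = π u) ∧ ∀ x, x ∉ U → Happy G π' x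

/-- The set of vertices of infinite degree. -/
def infVerts : Set V := {x | (G.neighborSet x).Infinite}

/-- The set of those vertices of infinite degree that have only finitely many neighbours of
infinite degree. -/
def starVerts : Set V := {x | x ∈ infVerts G ∧ (G.neighborSet x ∩ infVerts G).Finite}

end Partitions

/-! ### Classes of graphs and their closures -/

/-- A class of graphs. -/
def GraphClass : Type (u + 1) := ∀ V : Type u, SimpleGraph V → Prop

/-- The classes `𝒰(μ)`: `𝒰(0)` is `𝒰`, and for `μ > 0` the class `𝒰(μ)` consists of the graphs `G`
that have a finite vertex set `S` such that every component `C` of `G - S`, as a graph, lies in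
`𝒰(ν)` for some `ν < μ`. -/
def GraphClass.level (𝒰 : GraphClass.{u}) (μ : Ordinal.{u}) : GraphClass.{u} := fun V G =>
  (μ = 0 ∧ 𝒰 V G) ∨
  (μ ≠ 0 ∧ ∃ S : Set V, S.Finite ∧
    ∀ C : (G.induce Sᶜ).ConnectedComponent,
      ∃ ν : Ordinal.{u}, ∃ _ : ν < μ, 𝒰.level ν C.supp ((G.induce Sᶜ).induce C.supp))
termination_by μ

theorem GraphClass.level_zero (𝒰 : GraphClass.{u}) {V : Type u} (G : SimpleGraph V) :
    𝒰.level 0 V G ↔ 𝒰 V G := by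
  rw [GraphClass.level]; simp

theorem GraphClass.level_of_ne_zero (𝒰 : GraphClass.{u}) {μ : Ordinal.{u}} (hμ : μ ≠ 0)
    {V : Type u} (G : SimpleGraph V) :
    𝒰.level μ V G ↔ ∃ S : Set V, S.Finite ∧
      ∀ C : (G.induce Sᶜ).ConnectedComponent,
        ∃ ν < μ, 𝒰.level ν C.supp ((G.induce Sᶜ).induce C.supp) := by
  rw [GraphClass.level]; simp [hμ]

/-- The closure of `𝒰`: the union of the classes `𝒰(μ)` over all ordinals `μ`. -/
def GraphClass.closure (𝒰 : GraphClass.{u}) : GraphClass.{u} := fun V G =>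
  ∃ μ : Ordinal.{u}, 𝒰.level μ V G

/-- The class of countable graphs in which only finitely many vertices of infinite degree have
only finitely many neighbours of infinite degree. -/
def classW : GraphClass.{u} := fun V G => Countable V ∧ (starVerts G).Finite

end UnfriendlyPartition

namespace UnfriendlyPartition

/-! Plain happiness is too weak for an induction, so it is strengthened to `StronglyHappyOff`:
vertices of infinite degree are happy, and no finite recolouring of free vertices of finite degree
lowers the energy (friendly minus unfriendly edges). Energy minimality makes finite-degree vertices
happy and, unlike happiness, can be restored by a finite change whenever the possible decrease in
energy is bounded.

The heart is `ExtendableAbove.of_finite`: finitely many prescribed vertices can be released one at a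
time, in order of decreasing degree. Releasing `s` is easy if it has finite degree, is already
happy, or has only finitely many opponents: after flipping it if necessary, the energy stays bounded
below. If an unhappy `s` has infinitely many opponents, say `α` many, its degree exceeds `α`.
Flipping `s` can hurt only opponents of degree at most `α`; these lie in a set `X` of at most `α`
vertices closed under neighbours of degree at most `α`. Extendability above `B` recolours `X` alone:
the members of `B` still to be respected have degree above `α` and so lie outside `X`, and `α`
changes cannot harm a vertex of larger degree.

In the countable base case (`extendableAbove_of_countable`), first give each free vertex of infinite
degree infinitely many opponents that are prescribed or of infinite degree, then minimise the energy
on the rest by compactness. For higher levels, `extendableAbove_of_parts` glues extensions on the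
components of `G - S`, each taken together with `S`, and `S` is then released. Because `S` is kept
in every part, the induction in `extendableAbove_of_level` allows finitely many extra vertices. -/

open Cardinal

variable {V : Type u} {G : SimpleGraph V}

/-! ### Energy of partitions -/

open Classical in
/-- The energy of a pair of vertices: `1` for an edge between friends, `-1` for an edge between
opponents, and `0` for a non-edge. -/
noncomputable def pairEnergy (G : SimpleGraph V) (π : V → Bool) (p : V × V) : ℤ :=
  if G.Adj p.1 p.2 then (if π p.1 = π p.2 then 1 else -1) else 0

/-- The energy of `π'` minus the energy of `π`; meaningful if `π` and `π'` differ in only finitely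
many vertices, all of finite degree. -/
noncomputable def energyDiff (G : SimpleGraph V) (π π' : V → Bool) : ℤ :=
  ∑ᶠ p, (pairEnergy G π' p - pairEnergy G π p)

/-- The vertices in which two partitions differ. -/
def diffSet (π π' : V → Bool) : Set V := {x | π x ≠ π' x}

/-- No change of `π` in finitely many vertices of `L` lowers the energy. -/
def EnergyMinimal (G : SimpleGraph V) (L : Set V) (π : V → Bool) : Prop :=
  ∀ π', (diffSet π π').Finite → diffSet π π' ⊆ L → 0 ≤ energyDiff G π π'

theorem mem_diffSet {π π' : V → Bool} {x : V} : x ∈ diffSet π π' ↔ π x ≠ π' x := Iff.rfl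

theorem notMem_diffSet {π π' : V → Bool} {x : V} : x ∉ diffSet π π' ↔ π x = π' x := by
  simp [mem_diffSet]

theorem diffSet_subset_union (π ρ σ : V → Bool) : diffSet π σ ⊆ diffSet π ρ ∪ diffSet ρ σ := by
  intro x hx
  by_contra h
  simp only [Set.mem_union, not_or, notMem_diffSet] at h
  exact hx (h.1.trans h.2)

/-- The ordered pairs of adjacent vertices that meet a given set. -/
def touching (G : SimpleGraph V) (D : Set V) : Set (V × V) :=
  {p | G.Adj p.1 p.2 ∧ (p.1 ∈ D ∨ p.2 ∈ D)}

/-- This makes every energy difference considered below a finite sum. -/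
theorem finite_touching {D : Set V} (hD : D.Finite) (hL : D ⊆ (infVerts G)ᶜ) :
    (touching G D).Finite := by
  have hN : ∀ x ∈ D, (G.neighborSet x).Finite := fun x hx => Set.not_infinite.1 (hL hx)
  have h1 : (⋃ x ∈ D, (Prod.mk x) '' G.neighborSet x ∪ (fun y => (y, x)) '' G.neighborSet x).Finite :=
    hD.biUnion fun x hx => ((hN x hx).image _).union ((hN x hx).image _)
  refine h1.subset ?_
  rintro ⟨x, y⟩ ⟨hxy, h | h⟩
  · exact Set.mem_biUnion h (Or.inl ⟨y, hxy, rfl⟩)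
  · exact Set.mem_biUnion h (Or.inr ⟨x, hxy.symm, rfl⟩)

theorem support_subset_touching (π π' : V → Bool) :
    (Function.support fun p => pairEnergy G π' p - pairEnergy G π p) ⊆
      touching G (diffSet π π') := by
  rintro ⟨x, y⟩ h
  by_contra hc
  apply h
  by_cases hxy : G.Adj x y
  · have : π x = π' x ∧ π y = π' y := by
      simpa [touching, hxy, mem_diffSet] using hc
    simp [pairEnergy, this.1, this.2]
  · simp [pairEnergy, hxy]

theorem finite_support {π π' : V → Bool} (hf : (diffSet π π').Finite)
    (hL : diffSet π π' ⊆ (infVerts G)ᶜ) :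
    (Function.support fun p => pairEnergy G π' p - pairEnergy G π p).Finite :=
  (finite_touching hf hL).subset (support_subset_touching π π')

theorem energyDiff_add {π ρ σ : V → Bool} (hf : (diffSet π ρ).Finite)
    (hL : diffSet π ρ ⊆ (infVerts G)ᶜ) (hf' : (diffSet ρ σ).Finite)
    (hL' : diffSet ρ σ ⊆ (infVerts G)ᶜ) :
    energyDiff G π σ = energyDiff G π ρ + energyDiff G ρ σ := by
  unfold energyDiff
  rw [← finsum_add_distrib (finite_support hf hL) (finite_support hf' hL')]
  exact finsum_congr fun p => by ring

theorem abs_pairEnergy_sub_le (π π' : V → Bool) (p : V × V) :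
    |pairEnergy G π' p - pairEnergy G π p| ≤ 2 := by
  unfold pairEnergy
  split_ifs <;> simp

/-- Comparison of energy differences up to a bounded error on a finite set of pairs. -/
theorem energyDiff_le_add {π π' ρ ρ' : V → Bool}
    (hf : (diffSet π π').Finite) (hL : diffSet π π' ⊆ (infVerts G)ᶜ)
    (hf' : (diffSet ρ ρ').Finite) (hL' : diffSet ρ ρ' ⊆ (infVerts G)ᶜ)
    {P : Set (V × V)} (hP : P.Finite)
    (h : ∀ p ∉ P, pairEnergy G π' p - pairEnergy G π p ≤
      pairEnergy G ρ' p - pairEnergy G ρ p) :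
    energyDiff G π π' ≤ energyDiff G ρ ρ' + 4 * P.ncard := by
  classical
  have hT := (finite_support hf hL).union ((finite_support hf' hL').union hP)
  unfold energyDiff
  rw [finsum_eq_sum_of_support_subset (s := hT.toFinset) _ (by intro p hp; simp; left; simpa using hp),
    finsum_eq_sum_of_support_subset (s := hT.toFinset) _
      (by intro p hp; simp; right; left; simpa using hp)]
  -- Each of the two energy changes at a pair lies between -2 and 2, so on `P` they differ by at
  -- most 4.
  have hc : (4 * P.ncard : ℤ) = ∑ p ∈ hT.toFinset, if p ∈ P then 4 else 0 := by
    rw [← Finset.sum_filter, Finset.sum_const, Set.ncard_eq_toFinset_card P hP]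
    have : hT.toFinset.filter (· ∈ P) = hP.toFinset := by
      ext p; simp; tauto
    rw [this]; simp; ring
  rw [hc, ← Finset.sum_add_distrib]
  refine Finset.sum_le_sum fun p _ => ?_
  split_ifs with hp
  · have h1 := abs_le.1 (abs_pairEnergy_sub_le (G := G) π π' p)
    have h2 := abs_le.1 (abs_pairEnergy_sub_le (G := G) ρ ρ' p)
    linarith
  · simpa using h p hp

theorem energyDiff_mono {π π' ρ ρ' : V → Bool}
    (hf : (diffSet π π').Finite) (hL : diffSet π π' ⊆ (infVerts G)ᶜ)
    (hf' : (diffSet ρ ρ').Finite) (hL' : diffSet ρ ρ' ⊆ (infVerts G)ᶜ)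
    (h : ∀ p, pairEnergy G π' p - pairEnergy G π p ≤ pairEnergy G ρ' p - pairEnergy G ρ p) :
    energyDiff G π π' ≤ energyDiff G ρ ρ' := by
  simpa using energyDiff_le_add hf hL hf' hL' Set.finite_empty fun p _ => h p

theorem diffSet_self (π : V → Bool) : diffSet π π = ∅ := by ext; simp [mem_diffSet]

theorem energyDiff_self (π : V → Bool) : energyDiff G π π = 0 := by simp [energyDiff]

theorem EnergyMinimal.mono {L L' : Set V} {π : V → Bool} (h : EnergyMinimal G L π) (hL : L' ⊆ L) :
    EnergyMinimal G L' π := fun π' hf hs => h π' hf (hs.trans hL)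

/-- If the energy cannot be lowered indefinitely by changes inside `L`, then some finite change
inside `L` makes the partition energy minimal. -/
theorem exists_energyMinimal_of_bddBelow {L : Set V} (hL : L ⊆ (infVerts G)ᶜ) {π : V → Bool} (K : ℤ)
    (hK : ∀ π', (diffSet π π').Finite → diffSet π π' ⊆ L → K ≤ energyDiff G π π') :
    ∃ π', (diffSet π π').Finite ∧ diffSet π π' ⊆ L ∧ EnergyMinimal G L π' := by
  obtain ⟨m, ⟨π', hf, hs, rfl⟩, hm⟩ := Int.exists_least_of_bdd
    (P := fun m => ∃ π', (diffSet π π').Finite ∧ diffSet π π' ⊆ L ∧ energyDiff G π π' = m)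
    ⟨K, by rintro _ ⟨π', hf, hs, rfl⟩; exact hK π' hf hs⟩
    ⟨_, π, by simp [diffSet_self], by simp [diffSet_self], rfl⟩
  refine ⟨π', hf, hs, fun σ hσ hσL => ?_⟩
  have h1 := hm _ ⟨σ, (hf.union hσ).subset (diffSet_subset_union _ _ _),
    (diffSet_subset_union _ _ _).trans (Set.union_subset hs hσL), rfl⟩
  rw [energyDiff_add hf (hs.trans hL) hσ (hσL.trans hL)] at h1
  linarith

/-- Replace `π` by `π'` inside `D`. -/
noncomputable def patch (D : Set V) (π π' : V → Bool) : V → Bool :=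
  open Classical in fun x => if x ∈ D then π' x else π x

theorem patch_mem {D : Set V} {π π' : V → Bool} {x : V} (h : x ∈ D) : patch D π π' x = π' x := by
  simp [patch, h]

theorem patch_notMem {D : Set V} {π π' : V → Bool} {x : V} (h : x ∉ D) : patch D π π' x = π x := by
  simp [patch, h]

theorem diffSet_patch (D : Set V) (π π' : V → Bool) :
    diffSet π (patch D π π') = diffSet π π' ∩ D := by
  ext x
  by_cases h : x ∈ D <;> simp [mem_diffSet, patch_mem, patch_notMem, h]

/-- Energy differences are additive over changes on non-adjacent sets. -/
theorem energyDiff_split {π π' : V → Bool} (hf : (diffSet π π').Finite)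
    (hL : diffSet π π' ⊆ (infVerts G)ᶜ) {X : Set V}
    (hX : ∀ x ∈ diffSet π π', ∀ y ∈ diffSet π π', G.Adj x y → (x ∈ X ↔ y ∈ X)) :
    energyDiff G π π' = energyDiff G π (patch X π π') + energyDiff G π (patch Xᶜ π π') := by
  unfold energyDiff
  rw [← finsum_add_distrib]
  · refine finsum_congr ?_
    rintro ⟨x, y⟩
    have h := hX x
    by_cases hxy : G.Adj x y
    · by_cases hx : x ∈ diffSet π π' <;> by_cases hy : y ∈ diffSet π π' <;>
        by_cases hxX : x ∈ X <;> by_cases hyX : y ∈ X <;>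
        simp_all [pairEnergy, patch, mem_diffSet]
    · simp [pairEnergy, hxy]
  · exact finite_support (by rw [diffSet_patch]; exact hf.subset Set.inter_subset_left)
      (by rw [diffSet_patch]; exact Set.inter_subset_left.trans hL)
  · exact finite_support (by rw [diffSet_patch]; exact hf.subset Set.inter_subset_left)
      (by rw [diffSet_patch]; exact Set.inter_subset_left.trans hL)

open Classical in
/-- Flip the colours of the vertices in `F`. -/
noncomputable def flip (F : Set V) (π : V → Bool) : V → Bool := fun x => if x ∈ F then !π x else π x

theorem diffSet_flip (F : Set V) (π : V → Bool) : diffSet π (flip F π) = F := by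
  ext x; by_cases h : x ∈ F <;> simp [mem_diffSet, flip, h]

theorem flip_diffSet (π π' : V → Bool) : flip (diffSet π π') π = π' := by
  ext x
  cases h1 : π x <;> cases h2 : π' x <;> simp [flip, mem_diffSet, h1, h2]

/-- Test minimality against flipping `x` alone: friends and opponents of `x` are exchanged. -/
theorem EnergyMinimal.happy {L : Set V} {π : V → Bool} (h : EnergyMinimal G L π) {x : V}
    (hx : x ∈ L) (hfin : x ∉ infVerts G) : Happy G π x := by
  classical
  have hN : (G.neighborSet x).Finite := Set.not_infinite.1 hfin
  have h0 := h (flip {x} π) (by simp [diffSet_flip]) (by simpa [diffSet_flip] using hx)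
  have hff : (friends G π x).Finite := hN.subset fun y hy => hy.1
  have hof : (opponents G π x).Finite := hN.subset fun y hy => hy.1
  -- The factor 4 arises because each edge at `x` changes its energy by 2 and is counted as two
  -- ordered pairs.
  have key : energyDiff G π (flip {x} π) = 4 * (hof.toFinset.card - hff.toFinset.card) := by
    unfold energyDiff
    have e : ∀ p, pairEnergy G (flip {x} π) p - pairEnergy G π p =
        ((if p.1 = x ∧ p.2 ∈ hof.toFinset then (2 : ℤ) else 0) -
          (if p.1 = x ∧ p.2 ∈ hff.toFinset then 2 else 0)) +
        ((if p.2 = x ∧ p.1 ∈ hof.toFinset then (2 : ℤ) else 0) -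
          (if p.2 = x ∧ p.1 ∈ hff.toFinset then 2 else 0)) := by
      rintro ⟨a, b⟩
      by_cases hab : G.Adj a b
      · have hne := hab.ne
        by_cases ha : a = x
        · subst ha
          have hb : b ≠ a := hne.symm
          cases h1 : π a <;> cases h2 : π b <;>
            simp [pairEnergy, flip, opponents, friends, hab, hb, h1, h2]
        · by_cases hb : b = x
          · subst hb
            cases h1 : π a <;> cases h2 : π b <;>
              simp [pairEnergy, flip, opponents, friends, hab.symm, hab, ha, h1, h2]
          · simp [pairEnergy, flip, ha, hb]
      · have hba : ¬ G.Adj b a := fun h => hab h.symm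
        have h1 : ¬ (a = x ∧ G.Adj x b) := by rintro ⟨rfl, h⟩; exact hab h
        have h2 : ¬ (b = x ∧ G.Adj x a) := by rintro ⟨rfl, h⟩; exact hba h
        simp [pairEnergy, opponents, friends, hab, ← and_assoc, h1, h2]
    have hs1 : ∀ t : Finset V, ∑ᶠ p : V × V, (if p.1 = x ∧ p.2 ∈ t then (2 : ℤ) else 0)
        = 2 * t.card ∧ (Function.support fun p : V × V => if p.1 = x ∧ p.2 ∈ t then (2 : ℤ) else 0).Finite := by
      intro t
      have hsub : (Function.support fun p : V × V => if p.1 = x ∧ p.2 ∈ t then (2 : ℤ) else 0) ⊆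
          ((({x} : Finset V) ×ˢ t : Finset (V × V)) : Set (V × V)) := by
        rintro ⟨a, b⟩ hp
        have : a = x ∧ b ∈ t := by simpa using hp
        simp [this]
      refine ⟨?_, (Finset.finite_toSet _).subset hsub⟩
      rw [finsum_eq_sum_of_support_subset _ hsub]
      rw [Finset.sum_product]
      simp [mul_comm]
    have hs2 : ∀ t : Finset V, ∑ᶠ p : V × V, (if p.2 = x ∧ p.1 ∈ t then (2 : ℤ) else 0)
        = 2 * t.card ∧ (Function.support fun p : V × V => if p.2 = x ∧ p.1 ∈ t then (2 : ℤ) else 0).Finite := by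
      intro t
      have hsub : (Function.support fun p : V × V => if p.2 = x ∧ p.1 ∈ t then (2 : ℤ) else 0) ⊆
          ((t ×ˢ ({x} : Finset V) : Finset (V × V)) : Set (V × V)) := by
        rintro ⟨a, b⟩ hp
        have : b = x ∧ a ∈ t := by simpa using hp
        simp [this]
      refine ⟨?_, (Finset.finite_toSet _).subset hsub⟩
      rw [finsum_eq_sum_of_support_subset _ hsub]
      rw [Finset.sum_product]
      simp [mul_comm]
    rw [finsum_congr e, finsum_add_distrib, finsum_sub_distrib, finsum_sub_distrib, (hs1 _).1,
      (hs1 _).1, (hs2 _).1, (hs2 _).1]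
    · ring
    · exact (hs2 _).2
    · exact (hs2 _).2
    · exact (hs1 _).2
    · exact (hs1 _).2
    · exact ((hs1 hof.toFinset).2.union (hs1 hff.toFinset).2).subset (Function.support_sub _ _)
    · exact ((hs2 hof.toFinset).2.union (hs2 hff.toFinset).2).subset (Function.support_sub _ _)
  have hle : hff.toFinset.card ≤ hof.toFinset.card := by rw [key] at h0; omega
  unfold Happy
  have a1 := Cardinal.mk_coe_finset (s := hff.toFinset)
  have a2 := Cardinal.mk_coe_finset (s := hof.toFinset)
  simp only [Set.Finite.mem_toFinset] at a1 a2
  calc Cardinal.mk (friends G π x) = _ := a1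
    _ ≤ _ := by exact_mod_cast hle
    _ = _ := a2.symm

/-! ### Energy-minimal partitions by compactness -/

/-- Every partition can be changed inside a given set of vertices of finite degree so as to become
energy minimal there. -/
theorem exists_energyMinimal {L : Set V} (hL : L ⊆ (infVerts G)ᶜ) (π₀ : V → Bool) :
    ∃ π, (∀ x ∉ L, π x = π₀ x) ∧ EnergyMinimal G L π := by
  classical
  let K : {T : Finset V // (T : Set V) ⊆ L} → Set (V → Bool) := fun T =>
    {π | (∀ x ∉ L, π x = π₀ x) ∧ EnergyMinimal G T π}
  -- For fixed finite `F`, the energy change under flipping `F` depends on finitely many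
  -- coordinates, so minimality against `F` is a closed condition.
  have hcont : ∀ F : Set V, F.Finite → F ⊆ L →
      Continuous fun π => energyDiff G π (flip F π) := by
    intro F hF hFL
    have hT := finite_touching hF (hFL.trans hL)
    have : (fun π => energyDiff G π (flip F π)) = fun π => ∑ p ∈ hT.toFinset,
        (pairEnergy G (flip F π) p - pairEnergy G π p) := by
      ext π
      refine finsum_eq_sum_of_support_subset _ ((support_subset_touching _ _).trans ?_)
      rw [diffSet_flip]; simp
    rw [this]
    refine continuous_finsetSum _ fun p _ => ?_
    let g : Bool × Bool → ℤ := fun q =>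
      (if G.Adj p.1 p.2 then (if (if p.1 ∈ F then !q.1 else q.1) = (if p.2 ∈ F then !q.2 else q.2)
        then 1 else -1) else 0) - (if G.Adj p.1 p.2 then (if q.1 = q.2 then 1 else -1) else 0)
    have hg : Continuous g := continuous_of_discreteTopology
    have hp : Continuous fun π : V → Bool => (π p.1, π p.2) :=
      (continuous_apply p.1).prodMk (continuous_apply p.2)
    exact hg.comp hp
  have hclosed : ∀ T, IsClosed (K T) := by
    intro T
    have : K T = (⋂ x ∈ Lᶜ, {π | π x = π₀ x}) ∩
        ⋂ F ∈ {F : Set V | F ⊆ T.1}, {π | 0 ≤ energyDiff G π (flip F π)} := by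
      ext π
      simp only [K, Set.mem_ofPred_eq, Set.mem_inter_iff, Set.mem_iInter, Set.mem_compl_iff]
      refine and_congr Iff.rfl ⟨fun h F hF => ?_, fun h π' _ hs => ?_⟩
      · exact h _ (by rw [diffSet_flip]; exact T.1.finite_toSet.subset hF)
          (by rw [diffSet_flip]; exact hF)
      · simpa [flip_diffSet] using h _ hs
    rw [this]
    refine IsClosed.inter ?_ ?_
    · exact isClosed_biInter fun x _ => isClosed_eq (continuous_apply x) continuous_const
    · exact isClosed_biInter fun F hF => isClosed_le continuous_const
        (hcont F (T.1.finite_toSet.subset hF) (Set.Subset.trans hF T.2))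
  have : Nonempty {T : Finset V // (T : Set V) ⊆ L} := ⟨⟨∅, by simp⟩⟩
  have hne : (⋂ T, K T).Nonempty := by
    refine IsCompact.nonempty_iInter_of_directed_nonempty_isCompact_isClosed K ?_ ?_ ?_ ?_
    · intro T T'
      refine ⟨⟨T.1 ∪ T'.1, by simpa using ⟨T.2, T'.2⟩⟩, ?_, ?_⟩
      · exact fun π hπ => ⟨hπ.1, hπ.2.mono (by simp)⟩
      · exact fun π hπ => ⟨hπ.1, hπ.2.mono (by simp)⟩
    · intro T
      have hTf := finite_touching T.1.finite_toSet (T.2.trans hL)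
      -- Only the finitely many pairs touching `T` can change energy; the bound comes from
      -- comparison with the trivial change.
      obtain ⟨π, h1, h2, h3⟩ := exists_energyMinimal_of_bddBelow (G := G) (L := T.1) (T.2.trans hL)
        (π := π₀) (-(4 * (touching G (T.1 : Set V)).ncard)) (by
          intro π' hf hs
          have := energyDiff_le_add (G := G) (π := π₀) (π' := π₀) (ρ := π₀) (ρ' := π')
            (by simp [diffSet_self]) (by simp [diffSet_self]) hf (hs.trans (T.2.trans hL)) hTf
            (by
              intro p hp
              have : p ∉ Function.support fun p => pairEnergy G π' p - pairEnergy G π₀ p := by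
                intro hp'
                obtain ⟨ha, hb⟩ := support_subset_touching _ _ hp'
                exact hp ⟨ha, hb.imp (@hs _) (@hs _)⟩
              rw [Function.notMem_support.1 this]; simp)
          rw [energyDiff_self] at this
          linarith)
      refine ⟨π, fun x hx => ?_, h3⟩
      by_contra hne
      exact hx (T.2 (h2 (fun h => hne h.symm)))
    · exact fun T => (hclosed T).isCompact
    · exact hclosed
  obtain ⟨π, hπ⟩ := hne
  rw [Set.mem_iInter] at hπ
  refine ⟨π, (hπ ⟨∅, by simp⟩).1, fun π' hf hs => ?_⟩
  exact (hπ ⟨hf.toFinset, by simpa using hs⟩).2 π' hf (by simp)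

/-! ### Infinitely many opponents in countable graphs -/

/-- Countably many infinite sets can be split simultaneously into two infinite halves. -/
theorem exists_splitting {ι : Type*} [Countable ι] (A : ι → Set V) (hA : ∀ i, (A i).Infinite) :
    ∃ π : V → Bool, ∀ i b, {y ∈ A i | π y = b}.Infinite := by
  classical
  rcases isEmpty_or_nonempty ι with h | h
  · exact ⟨fun _ => false, fun i => h.elim i⟩
  -- The factor `ℕ` makes each request "a new vertex of `A i` with colour `b`" occur infinitely
  -- often; the requests are met by distinct vertices `y n`.
  obtain ⟨e, he⟩ := exists_surjective_nat (ι × ℕ × Bool)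
  choose pick hpick hpick' using fun (i : ι) (s : Finset V) => (hA i).exists_notMem_finset s
  let F : ℕ → Finset V := fun n => Nat.rec ∅ (fun n s => insert (pick (e n).1 s) s) n
  let y : ℕ → V := fun n => pick (e n).1 (F n)
  have hF : ∀ n, F (n + 1) = insert (y n) (F n) := fun n => rfl
  have hmono : Monotone F := monotone_nat_of_le_succ fun n => by rw [hF]; exact Finset.subset_insert _ _
  have hy : ∀ m n, m < n → y m ≠ y n := by
    intro m n hmn heq
    have h1 : y m ∈ F n := hmono hmn (by rw [hF]; exact Finset.mem_insert_self _ _)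
    rw [heq] at h1
    exact hpick' _ _ h1
  have hinj : Function.Injective y := by
    intro m n h
    rcases lt_trichotomy m n with h' | h' | h'
    · exact (hy _ _ h' h).elim
    · exact h'
    · exact (hy _ _ h' h.symm).elim
  refine ⟨fun v => if h : ∃ n, y n = v then (e h.choose).2.2 else false, fun i b => ?_⟩
  choose f hf using fun k : ℕ => he (i, k, b)
  refine Set.infinite_of_injective_forall_mem (f := fun k => y (f k)) ?_ ?_
  · intro k l hkl
    have := congrArg e (hinj hkl)
    rw [hf, hf] at this
    simpa using this
  · intro k
    refine ⟨?_, ?_⟩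
    · have := hpick (e (f k)).1 (F (f k))
      rw [hf] at this
      simpa [y, hf] using this
    · have hex : ∃ n, y n = y (f k) := ⟨_, rfl⟩
      have : hex.choose = f k := hinj hex.choose_spec
      simp only [hex, ↓reduceDIte]
      rw [this, hf]

/-- In a countable graph, a partition of `W` extends so that every vertex of `J` with infinitely
many neighbours in `J ∪ W` gets infinitely many opponents. -/
theorem exists_infinite_opponents [Countable V] (W J : Set V)
    (hJ : ∀ x ∈ J, (G.neighborSet x ∩ (J ∪ W)).Infinite) (hWJ : Disjoint W J) (ρ : V → Bool) :
    ∃ π : V → Bool, (∀ x ∈ W, π x = ρ x) ∧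
      ∀ x ∈ J, (opponents G π x ∩ (J ∪ W)).Infinite := by
  classical
  -- Zorn's lemma is applied to partial colourings on sets `D` between `W` and `J ∪ W` in which each
  -- vertex of `J ∩ D` already has infinitely many opponents inside `D`.
  let r : Set V × (V → Bool) → Set V × (V → Bool) → Prop := fun p q =>
    p.1 ⊆ q.1 ∧ ∀ x ∈ p.1, q.2 x = p.2 x
  let good : Set V × (V → Bool) → Prop := fun p => W ⊆ p.1 ∧ p.1 ⊆ J ∪ W ∧ (∀ x ∈ W, p.2 x = ρ x) ∧
    ∀ x ∈ J ∩ p.1, (opponents G p.2 x ∩ p.1).Infinite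
  have hopp : ∀ p q, r p q → ∀ x ∈ p.1, opponents G p.2 x ∩ p.1 ⊆ opponents G q.2 x ∩ q.1 := by
    rintro p q ⟨h1, h2⟩ x hx y ⟨⟨ha, hne⟩, hy⟩
    exact ⟨⟨ha, by rw [h2 x hx, h2 y hy]; exact hne⟩, h1 hy⟩
  let r' : {p // good p} → {p // good p} → Prop := fun p q => r p.1 q.1
  obtain ⟨⟨⟨D, π⟩, hW, hDJ, hπW, hπ⟩, hmax⟩ : ∃ m : {p // good p}, ∀ a, r' m a → r' a m := by
    apply exists_maximal_of_chains_bounded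
    · intro c hc
      rcases c.eq_empty_or_nonempty with rfl | ⟨p₀, hp₀⟩
      · exact ⟨⟨(W, ρ), subset_rfl, Set.subset_union_right, fun _ _ => rfl, fun x hx =>
          (hWJ.le_bot ⟨hx.2, hx.1⟩).elim⟩, by simp⟩
      let σ : V → Bool := fun v => if h : ∃ p ∈ c, v ∈ p.1.1 then h.choose.1.2 v else false
      have hσ : ∀ p ∈ c, ∀ v ∈ p.1.1, σ v = p.1.2 v := by
        intro p hp v hv
        have h : ∃ p ∈ c, v ∈ p.1.1 := ⟨p, hp, hv⟩
        have hq := h.choose_spec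
        simp only [σ, h, ↓reduceDIte]
        rcases eq_or_ne h.choose p with e | e
        · rw [e]
        rcases hc hq.1 hp e with h' | h'
        · exact (h'.2 v hq.2).symm
        · exact h'.2 v hv
      have hub : ∀ p ∈ c, r p.1 (⋃ p ∈ c, p.1.1, σ) := fun p hp =>
        ⟨Set.subset_biUnion_of_mem (u := fun p => p.1.1) hp, hσ p hp⟩
      refine ⟨⟨(⋃ p ∈ c, p.1.1, σ), p₀.2.1.trans (hub p₀ hp₀).1,
        Set.iUnion₂_subset fun p _ => p.2.2.1, ?_, ?_⟩, hub⟩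
      · intro x hx
        rw [← p₀.2.2.2.1 x hx]
        exact hσ _ hp₀ _ (p₀.2.1 hx)
      · rintro x ⟨hxJ, hx⟩
        obtain ⟨p, hp, hxp⟩ := Set.mem_iUnion₂.1 hx
        exact (p.2.2.2.2 x ⟨hxJ, hxp⟩).mono (hopp _ _ (hub p hp) x hxp)
    · rintro p q s ⟨h1, h2⟩ ⟨h3, h4⟩
      exact ⟨h1.trans h3, fun x hx => (h4 x (h1 hx)).trans (h2 x hx)⟩
  dsimp only at hDJ hW hπW hπ
  -- Otherwise some colour occurs infinitely often among the neighbours of `x` in `D`, and giving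
  -- `x` the other colour enlarges `D`.
  have hfin : ∀ x ∈ J \ D, (G.neighborSet x ∩ D).Finite := by
    rintro x ⟨hxJ, hxD⟩
    by_contra hinf
    have hun : G.neighborSet x ∩ D = {y ∈ G.neighborSet x ∩ D | π y = true} ∪
        {y ∈ G.neighborSet x ∩ D | π y = false} := by
      ext y; cases h : π y <;> simp [h]
    obtain ⟨b, hb⟩ : ∃ b, {y ∈ G.neighborSet x ∩ D | π y = b}.Infinite := by
      rw [hun] at hinf
      rcases Set.infinite_union.1 hinf with h | h
      exacts [⟨_, h⟩, ⟨_, h⟩]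
    let π' := Function.update π x (!b)
    have hπ' : ∀ y ∈ D, π' y = π y := fun y hy =>
      Function.update_of_ne (by rintro rfl; exact hxD hy) _ _
    have hr : r (D, π) (insert x D, π') := ⟨Set.subset_insert _ _, hπ'⟩
    have hg : good (insert x D, π') := by
      refine ⟨hW.trans (Set.subset_insert _ _),
        Set.insert_subset (Or.inl hxJ) hDJ, fun y hy => ?_, ?_⟩
      · rw [← hπW y hy]; exact hπ' y (hW hy)
      · rintro y ⟨hyJ, hy⟩
        rcases (Set.mem_insert_iff.1 hy) with rfl | hy
        · refine hb.mono ?_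
          rintro z ⟨⟨hz, hzD⟩, hzb⟩
          refine ⟨⟨hz, ?_⟩, Set.mem_insert_of_mem _ hzD⟩
          change π' z ≠ π' y
          rw [hπ' z hzD, hzb]; simp [π']
        · exact (hπ y ⟨hyJ, hy⟩).mono (hopp _ _ hr y hy)
    exact hxD ((hmax ⟨_, hg⟩ hr).1 (Set.mem_insert x D))
  -- The remaining vertices thus have infinitely many neighbours among themselves, and a splitting
  -- of these neighbourhoods serves them all.
  have hinf : ∀ x : ↥(J \ D), (G.neighborSet x ∩ (J \ D)).Infinite := by
    rintro ⟨x, hx⟩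
    refine ((hJ x hx.1).sdiff (hfin x hx)).mono ?_
    rintro y ⟨⟨hy, hy'⟩, hyD⟩
    refine ⟨hy, ?_, fun h => hyD ⟨hy, h⟩⟩
    exact hy'.resolve_right fun h => hyD ⟨hy, hW h⟩
  obtain ⟨τ, hτ⟩ := exists_splitting (fun x : ↥(J \ D) => G.neighborSet x ∩ (J \ D)) hinf
  refine ⟨fun v => if v ∈ D then π v else τ v, fun x hx => ?_, fun x hx => ?_⟩
  · simpa [hW hx] using hπW x hx
  · by_cases hxD : x ∈ D
    · refine (hπ x ⟨hx, hxD⟩).mono ?_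
      rintro y ⟨⟨hy, hne⟩, hyD⟩
      exact ⟨⟨hy, by simpa [hxD, hyD] using hne⟩, hDJ hyD⟩
    · refine (hτ ⟨x, hx, hxD⟩ (!τ x)).mono ?_
      rintro y ⟨⟨hy, hyJ⟩, he⟩
      exact ⟨⟨hy, by simp [hxD, hyJ.2, he]⟩, Or.inl hyJ.1⟩

/-! ### Strong happiness and extendability -/

/-- Outside `A`, all vertices of infinite degree are happy in `π` and `π` is energy minimal on the
vertices of finite degree. -/
structure StronglyHappyOff (G : SimpleGraph V) (A : Set V) (π : V → Bool) : Prop where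
  happy : ∀ x ∈ infVerts G, x ∉ A → Happy G π x
  minimal : EnergyMinimal G ((infVerts G)ᶜ \ A) π

/-- Every partition of every superset `W` of `B` extends to a partition that is strongly happy off
`W`. -/
def ExtendableAbove (G : SimpleGraph V) (B : Set V) : Prop :=
  ∀ W, B ⊆ W → ∀ ρ : V → Bool, ∃ π, (∀ x ∈ W, π x = ρ x) ∧ StronglyHappyOff G W π

theorem StronglyHappyOff.happy_of_notMem {A : Set V} {π : V → Bool} (h : StronglyHappyOff G A π)
    {x : V} (hx : x ∉ A) : Happy G π x := by
  by_cases hi : x ∈ infVerts G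
  · exact h.happy x hi hx
  · exact h.minimal.happy ⟨hi, hx⟩ hi

theorem ExtendableAbove.prePartitionable (h : ExtendableAbove G ∅) : PrePartitionable G := by
  classical
  intro U π
  obtain ⟨π', h1, h2⟩ := h U (Set.empty_subset _) fun v => if hv : v ∈ U then π ⟨v, hv⟩ else false
  exact ⟨π', fun u => by rw [h1 u u.2]; simp, fun x hx => h2.happy_of_notMem hx⟩

/-! ### Stability of happiness under few changes -/

theorem neighborSet_eq_union (π : V → Bool) (x : V) :
    G.neighborSet x = friends G π x ∪ opponents G π x := by
  ext y
  simp only [friends, opponents, Set.mem_union, Set.mem_ofPred_eq, SimpleGraph.mem_neighborSet]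
  tauto

theorem aleph0_le_degree {x : V} (hx : x ∈ infVerts G) : ℵ₀ ≤ #(G.neighborSet x) :=
  Cardinal.infinite_iff.1 (Set.infinite_coe_iff.2 hx)

/-- A vertex of infinite degree is happy if and only if its opponents are as numerous as its
neighbours. -/
theorem happy_iff_of_mem_infVerts {π : V → Bool} {x : V} (hx : x ∈ infVerts G) :
    Happy G π x ↔ #(G.neighborSet x) ≤ #(opponents G π x) := by
  refine ⟨fun h => ?_, fun h => (mk_le_mk_of_subset fun y hy => hy.1).trans h⟩
  by_contra! hlt
  have : #(G.neighborSet x) ≤ #(friends G π x) + #(opponents G π x) := by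
    rw [neighborSet_eq_union π x]; exact mk_union_le _ _
  exact absurd this (not_le.2 (add_lt_of_lt (aleph0_le_degree hx) (lt_of_le_of_lt h hlt) hlt))

/-- Happiness of a vertex of infinite degree is not affected by few changes. -/
theorem Happy.of_diffSet_lt {π π' : V → Bool} {x : V} (h : Happy G π x) (hx : x ∈ infVerts G)
    (he : π x = π' x) (hlt : #(diffSet π π') < #(G.neighborSet x)) : Happy G π' x := by
  rw [happy_iff_of_mem_infVerts hx] at h ⊢
  by_contra! hc
  have hsub : opponents G π x ⊆ opponents G π' x ∪ diffSet π π' := by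
    rintro y ⟨hy, hne⟩
    by_cases hd : y ∈ diffSet π π'
    · exact Or.inr hd
    · exact Or.inl ⟨hy, by rwa [← he, ← notMem_diffSet.1 hd]⟩
  have := h.trans ((mk_le_mk_of_subset hsub).trans (mk_union_le _ _))
  exact absurd this (not_le.2 (add_lt_of_lt (aleph0_le_degree hx) hc hlt))

theorem Happy.of_finite_diffSet {π π' : V → Bool} {x : V} (h : Happy G π x) (hx : x ∈ infVerts G)
    (he : π x = π' x) (hf : (diffSet π π').Finite) : Happy G π' x :=
  h.of_diffSet_lt hx he ((lt_aleph0_iff_set_finite.2 hf).trans_le (aleph0_le_degree hx))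

theorem opponents_flip_singleton (π : V → Bool) (s : V) :
    opponents G (flip {s} π) s = friends G π s := by
  ext y
  simp only [opponents, friends, Set.mem_ofPred_eq]
  refine and_congr_right fun h => ?_
  have : y ≠ s := h.ne'
  cases h1 : π s <;> cases h2 : π y <;> simp [flip, this, h1, h2]

theorem friends_flip_singleton (π : V → Bool) (s : V) :
    friends G (flip {s} π) s = opponents G π s := by
  ext y
  simp only [opponents, friends, Set.mem_ofPred_eq]
  refine and_congr_right fun h => ?_
  have : y ≠ s := h.ne'
  cases h1 : π s <;> cases h2 : π y <;> simp [flip, this, h1, h2]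

/-- Flipping `s` does not hurt a vertex that is not an opponent of `s`. -/
theorem Happy.flip_singleton {π : V → Bool} {s x : V} (h : Happy G π x) (hxs : x ≠ s)
    (hx : x ∉ opponents G π s) : Happy G (flip {s} π) x := by
  have key : ∀ y, G.Adj x y → π y ≠ π x → flip {s} π y ≠ flip {s} π x := by
    intro y hy hne
    have : y ≠ s := by rintro rfl; exact hx ⟨hy.symm, hne.symm⟩
    simpa [flip, this, hxs] using hne
  refine (mk_le_mk_of_subset ?_).trans (h.trans (mk_le_mk_of_subset ?_))
  · rintro y ⟨hy, he⟩
    exact ⟨hy, by by_contra hne; exact key y hy hne he⟩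
  · rintro y ⟨hy, hne⟩
    exact ⟨hy, key y hy hne⟩

/-- Up to `α` many vertices of degree at most `α` lie in a set of at most `α` vertices that is
closed under taking neighbours of degree at most `α`. -/
theorem exists_small_closed {α : Cardinal.{u}} (hα : ℵ₀ ≤ α) (D : Set V) (hD : #D ≤ α) :
    ∃ X : Set V, #X ≤ α ∧ (∀ x ∈ X, #(G.neighborSet x) ≤ α) ∧
      (∀ x ∈ D, #(G.neighborSet x) ≤ α → x ∈ X) ∧
      ∀ x ∈ X, ∀ y, G.Adj x y → #(G.neighborSet y) ≤ α → y ∈ X := by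
  let low : Set V := {x | #(G.neighborSet x) ≤ α}
  let X : ℕ → Set V := fun n => Nat.rec (motive := fun _ => Set V) (D ∩ low) (fun _ Y => ⋃ x : Y, G.neighborSet (x : V) ∩ low) n
  have hs : ∀ n, X (n + 1) = ⋃ x : X n, G.neighborSet (x : V) ∩ low := fun n => rfl
  have hlow : ∀ n, X n ⊆ low := by
    rintro (_ | n)
    · exact Set.inter_subset_right
    · rw [hs]; exact Set.iUnion_subset fun x => Set.inter_subset_right
  have hcard : ∀ n, #(X n) ≤ α := by
    intro n
    induction n with
    | zero => exact (mk_le_mk_of_subset Set.inter_subset_left).trans hD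
    | succ n ih =>
      rw [hs]
      refine (mk_iUnion_le _).trans ((mul_le_mul' ih (ciSup_le' fun x => ?_)).trans
        (mul_eq_self hα).le)
      exact (mk_le_mk_of_subset Set.inter_subset_left).trans (hlow n x.2)
  refine ⟨⋃ n, X n, ?_, ?_, ?_, ?_⟩
  · rw [← Equiv.ulift.{u, 0}.surjective.iUnion_comp]
    refine (mk_iUnion_le _).trans ((mul_le_mul' ?_ (ciSup_le' fun n => hcard _)).trans
      (mul_eq_self hα).le)
    exact (mk_le_aleph0 (α := ULift.{u} ℕ)).trans hα
  · intro x hx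
    obtain ⟨n, hn⟩ := Set.mem_iUnion.1 hx
    exact hlow n hn
  · exact fun x hx h => Set.mem_iUnion.2 ⟨0, hx, h⟩
  · intro x hx y hxy hy
    obtain ⟨n, hn⟩ := Set.mem_iUnion.1 hx
    exact Set.mem_iUnion.2 ⟨n + 1, by rw [hs]; exact Set.mem_iUnion.2 ⟨⟨x, hn⟩, hxy, hy⟩⟩

theorem Happy.congr {π π' : V → Bool} {x : V} (h : Happy G π x) (hx : π x = π' x)
    (hN : ∀ y, G.Adj x y → π y = π' y) : Happy G π' x := by
  have h1 : friends G π' x = friends G π x := by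
    ext y
    exact and_congr_right fun hy => by rw [hx, hN y hy]
  have h2 : opponents G π' x = opponents G π x := by
    ext y
    exact and_congr_right fun hy => by rw [hx, hN y hy]
  unfold Happy
  rw [h1, h2]
  exact h

theorem happy_flip_singleton_self {π : V → Bool} {s : V} (h : ¬ Happy G π s) :
    Happy G (flip {s} π) s := by
  unfold Happy at h ⊢
  rw [friends_flip_singleton, opponents_flip_singleton]
  exact (not_le.1 h).le

theorem pairEnergy_swap (π : V → Bool) (x y : V) :
    pairEnergy G π (x, y) = pairEnergy G π (y, x) := by
  by_cases h : G.Adj x y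
  · simp [pairEnergy, h, h.symm, eq_comm]
  · have h' : ¬ G.Adj y x := fun h' => h h'.symm
    simp [pairEnergy, h, h']

theorem pairEnergy_of_not_adj (π : V → Bool) {x y : V} (h : ¬ G.Adj x y) :
    pairEnergy G π (x, y) = 0 := by
  simp [pairEnergy, h]

theorem pairEnergy_congr {π π' : V → Bool} {x y : V} (hx : π x = π' x) (hy : π y = π' y) :
    pairEnergy G π (x, y) = pairEnergy G π' (x, y) := by
  simp [pairEnergy, hx, hy]

theorem pairEnergy_le_one (π : V → Bool) (p : V × V) : pairEnergy G π p ≤ 1 := by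
  unfold pairEnergy; split_ifs <;> simp

theorem neg_one_le_pairEnergy (π : V → Bool) (p : V × V) : -1 ≤ pairEnergy G π p := by
  unfold pairEnergy; split_ifs <;> simp

theorem pairEnergy_of_eq {π : V → Bool} {x y : V} (h : G.Adj x y) (he : π x = π y) :
    pairEnergy G π (x, y) = 1 := by
  simp [pairEnergy, h, he]

theorem pairEnergy_of_ne {π : V → Bool} {x y : V} (h : G.Adj x y) (he : π x ≠ π y) :
    pairEnergy G π (x, y) = -1 := by
  simp [pairEnergy, h, he]

/-! ### Releasing one prescribed vertex -/

section Release

variable {A : Set V} {π : V → Bool} {s : V}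

theorem StronglyHappyOff.of_happy (h : StronglyHappyOff G (insert s A) π)
    (hs : s ∈ infVerts G) (hh : Happy G π s) : StronglyHappyOff G A π := by
  refine ⟨fun x hx hxA => ?_, ?_⟩
  · by_cases hxs : x = s
    · rwa [hxs]
    · exact h.happy x hx (by simp [hxs, hxA])
  · refine h.minimal.mono ?_
    rintro x ⟨hx, hxA⟩
    refine ⟨hx, ?_⟩
    rintro (rfl | hx')
    exacts [hx hs, hxA hx']

/-- Freeing `s` affects only its finitely many edges, so the energy remains bounded below and a
finite change restores minimality. Finite changes leave vertices of infinite degree happy. -/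
theorem StronglyHappyOff.release_of_finite_degree (h : StronglyHappyOff G (insert s A) π)
    (hs : s ∉ infVerts G) :
    ∃ π', (∀ x ∈ A, π' x = π x) ∧ StronglyHappyOff G A π' := by
  have hT : (touching G {s}).Finite := finite_touching (by simp) (by simpa using hs)
  have hL : (infVerts G)ᶜ \ A ⊆ (infVerts G)ᶜ := Set.sdiff_subset
  obtain ⟨π', hf, hsub, hmin⟩ := exists_energyMinimal_of_bddBelow (π := π) hL
    (-(4 * (touching G {s}).ncard)) (by
      intro π' hf hsub
      have hd := diffSet_patch {s}ᶜ π π'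
      have hf' : (diffSet π (patch {s}ᶜ π π')).Finite := by
        rw [hd]; exact hf.subset Set.inter_subset_left
      have hs' : diffSet π (patch {s}ᶜ π π') ⊆ (infVerts G)ᶜ \ insert s A := by
        rw [hd]
        rintro x ⟨hx, hxs⟩
        refine ⟨(hsub hx).1, ?_⟩
        rintro (h | h)
        exacts [hxs h, (hsub hx).2 h]
      have h0 := h.minimal _ hf' hs'
      have := energyDiff_le_add (G := G) hf' (hs'.trans Set.sdiff_subset) hf (hsub.trans hL) hT (by
        rintro ⟨x, y⟩ hp
        by_cases hxy : G.Adj x y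
        · have : x ≠ s ∧ y ≠ s := by simpa [touching, hxy] using hp
          rw [pairEnergy_congr (π := patch {s}ᶜ π π') (π' := π') (patch_mem (by simpa using this.1))
            (patch_mem (by simpa using this.2))]
        · simp [pairEnergy_of_not_adj _ hxy])
      linarith)
  refine ⟨π', fun x hx => ?_, ⟨fun x hx hxA => ?_, hmin⟩⟩
  · exact (notMem_diffSet.1 fun h' => (hsub h').2 hx).symm
  · refine (h.happy x hx ?_).of_finite_diffSet hx (notMem_diffSet.1 fun h' => (hsub h').1 hx) hf
    rintro (rfl | h')
    exacts [hs hx, hxA h']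

/-- After flipping `s`, all but finitely many of its edges join opponents and have the least
possible energy. Only the finitely many former opponents can allow a decrease, so a finite change
restores minimality. -/
theorem StronglyHappyOff.release_of_finite_opponents (h : StronglyHappyOff G (insert s A) π)
    (hs : s ∈ infVerts G) (hsA : s ∉ A) (hu : ¬ Happy G π s) (ho : (opponents G π s).Finite) :
    ∃ π', (∀ x ∈ A, π' x = π x) ∧ StronglyHappyOff G A π' := by
  have hP : ((Prod.mk s '' opponents G π s) ∪ ((fun y => (y, s)) '' opponents G π s)).Finite :=
    (ho.image _).union (ho.image _)
  set P := (Prod.mk s '' opponents G π s) ∪ ((fun y => (y, s)) '' opponents G π s) with hPdef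
  have hL : (infVerts G)ᶜ \ A ⊆ (infVerts G)ᶜ := Set.sdiff_subset
  have hflip : ∀ x, x ≠ s → flip {s} π x = π x := fun x hx => by simp [flip, hx]
  obtain ⟨π', hf, hsub, hmin⟩ := exists_energyMinimal_of_bddBelow (π := flip {s} π) hL
    (-(4 * P.ncard)) (by
      intro π' hf hsub
      have hss : flip {s} π s = π' s := notMem_diffSet.1 fun h' => (hsub h').1 hs
      -- `patch {s} π' π` is `π'` with the old colour of `s` restored, a legitimate competitor to
      -- `π`.
      have hd : diffSet π (patch {s} π' π) ⊆ diffSet (flip {s} π) π' := by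
        intro x hx
        have hxs : x ≠ s := by
          rintro rfl
          exact hx (patch_mem (by simp)).symm
        rw [mem_diffSet, patch_notMem (by simpa using hxs)] at hx
        rwa [mem_diffSet, hflip x hxs]
      have hf' := hf.subset hd
      have hs' : diffSet π (patch {s} π' π) ⊆ (infVerts G)ᶜ \ insert s A := by
        intro x hx
        refine ⟨(hsub (hd hx)).1, ?_⟩
        rintro (rfl | h)
        exacts [(hsub (hd hx)).1 hs, (hsub (hd hx)).2 h]
      have h0 := h.minimal _ hf' hs'
      have key : ∀ y, G.Adj s y → y ∉ opponents G π s →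
          pairEnergy G (patch {s} π' π) (s, y) - pairEnergy G π (s, y) ≤
          pairEnergy G π' (s, y) - pairEnergy G (flip {s} π) (s, y) := by
        intro y hy hyo
        have hye : π y = π s := by
          by_contra hne; exact hyo ⟨hy, hne⟩
        have hys : y ≠ s := hy.ne'
        rw [pairEnergy_of_eq (π := π) hy hye.symm, pairEnergy_of_ne (π := flip {s} π) hy
          (by simp [flip, hys, hye])]
        have h1 := pairEnergy_le_one (G := G) (patch {s} π' π) (s, y)
        have h2 := neg_one_le_pairEnergy (G := G) π' (s, y)
        linarith
      have := energyDiff_le_add (G := G) hf' (hs'.trans Set.sdiff_subset) hf (hsub.trans hL) hP (by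
        rintro ⟨x, y⟩ hp
        by_cases hxy : G.Adj x y
        · by_cases hx : x = s
          · subst hx
            exact key y hxy fun hy => hp (Or.inl ⟨y, hy, rfl⟩)
          by_cases hy : y = s
          · subst hy
            simp only [pairEnergy_swap _ x y]
            exact key x hxy.symm fun hx => hp (Or.inr ⟨x, hx, rfl⟩)
          rw [pairEnergy_congr (π := patch {s} π' π) (π' := π') (patch_notMem (by simpa using hx))
            (patch_notMem (by simpa using hy)), pairEnergy_congr (hflip x hx) (hflip y hy)]
        · simp [pairEnergy_of_not_adj _ hxy])
      linarith)
  refine ⟨π', fun x hx => ?_, ⟨fun x hx hxA => ?_, hmin⟩⟩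
  · rw [← hflip x (by rintro rfl; exact hsA hx)]
    exact (notMem_diffSet.1 fun h' => (hsub h').2 hx).symm
  · have hxe : flip {s} π x = π' x := notMem_diffSet.1 fun h' => (hsub h').1 hx
    by_cases hxs : x = s
    · subst hxs
      exact (happy_flip_singleton_self hu).of_finite_diffSet hx hxe hf
    · refine (h.happy x hx (by simp [hxs, hxA])).of_finite_diffSet hx
        ((hflip x hxs).symm.trans hxe) (Set.Finite.subset ?_ (diffSet_subset_union π (flip {s} π) π'))
      rw [diffSet_flip]
      exact (Set.finite_singleton s).union hf

/-- Flip `s` and use `hB` to recolour only `X \ A`, where `X` absorbs all damage done by the flip.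
The degree condition keeps `B` disjoint from the recoloured set. -/
theorem StronglyHappyOff.release_of_infinite_opponents {B : Set V} (hB : ExtendableAbove G B)
    (h : StronglyHappyOff G (insert s A) π) (hs : s ∈ infVerts G) (hsA : s ∉ A)
    (hdeg : ∀ t ∈ B, t ∉ A → #(G.neighborSet s) ≤ #(G.neighborSet t))
    (hu : ¬ Happy G π s) (ho : (opponents G π s).Infinite) :
    ∃ π', (∀ x ∈ A, π' x = π x) ∧ StronglyHappyOff G A π' := by
  have hα : ℵ₀ ≤ #(opponents G π s) := Cardinal.infinite_iff.1 (Set.infinite_coe_iff.2 ho)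
  have hlt : #(opponents G π s) < #(G.neighborSet s) :=
    (not_le.1 hu).trans_le (mk_le_mk_of_subset fun y hy => hy.1)
  obtain ⟨X, hXc, hXlow, hDX, hXcl⟩ := exists_small_closed (G := G) hα (opponents G π s) le_rfl
  generalize #(opponents G π s) = α at hα hlt hXc hXlow hDX hXcl
  have hfin : ∀ x ∉ infVerts G, #(G.neighborSet x) ≤ α := fun x hx =>
    (lt_aleph0_iff_set_finite.2 (Set.not_infinite.1 hx)).le.trans hα
  have hsX : s ∉ X := fun hX => (hXlow s hX).not_gt hlt
  obtain ⟨π₂, heq, hgood⟩ := hB (X \ A)ᶜ (by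
    rintro t ht ⟨htX, htA⟩
    exact ((hdeg t ht htA).trans (hXlow t htX)).not_gt hlt) (flip {s} π)
  have hflip : ∀ x, x ≠ s → flip {s} π x = π x := fun x hx => by simp [flip, hx]
  have heq' : ∀ x ∉ X, π₂ x = flip {s} π x := fun x hx => heq x fun h' => hx h'.1
  have heq2 : ∀ x ∉ X, x ≠ s → π₂ x = π x := fun x hx hxs => (heq' x hx).trans (hflip x hxs)
  have hd1 : diffSet (flip {s} π) π₂ ⊆ X := fun x hx => by
    by_contra hX; exact hx (heq' x hX).symm
  have hd1c : #(diffSet (flip {s} π) π₂) ≤ α := (mk_le_mk_of_subset hd1).trans hXc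
  have hd2c : #(diffSet π π₂) ≤ α := by
    refine (mk_le_mk_of_subset (diffSet_subset_union π (flip {s} π) π₂)).trans
      ((mk_union_le _ _).trans (add_le_of_le hα ?_ hd1c))
    rw [diffSet_flip, mk_singleton]
    exact one_le_aleph0.trans hα
  refine ⟨π₂, fun x hx => ?_, ⟨fun x hx hxA => ?_, fun π' hf hsub => ?_⟩⟩
  · rw [heq x fun h' => h'.2 hx]
    exact hflip x (by rintro rfl; exact hsA hx)
  · by_cases hxs : x = s
    · subst hxs
      exact (happy_flip_singleton_self hu).of_diffSet_lt hx (heq' x hsX).symm (hd1c.trans_lt hlt)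
    by_cases hxX : x ∈ X
    · exact hgood.happy x hx fun h' => h' ⟨hxX, hxA⟩
    have hhap := h.happy x hx (by simp [hxs, hxA])
    -- Outside `X`, a vertex of degree at most `α` has no neighbour in `X` and is no old opponent of
    -- `s`; one of larger degree tolerates `α` changes.
    by_cases hdx : #(G.neighborSet x) ≤ α
    · refine (hhap.flip_singleton hxs fun h' => hxX (hDX x h' hdx)).congr (heq' x hxX).symm ?_
      intro y hy
      exact (heq' y fun hyX => hxX (hXcl y hyX x hy.symm hdx)).symm
    · exact hhap.of_diffSet_lt hx (heq2 x hxX hxs).symm (hd2c.trans_lt (not_le.1 hdx))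
  · have hL : diffSet π₂ π' ⊆ (infVerts G)ᶜ := hsub.trans Set.sdiff_subset
    -- No edge joins finite-degree vertices inside and outside `X`. Changes inside are controlled by
    -- the new partition, those outside by the minimality of `π`.
    rw [energyDiff_split hf hL (X := X) fun x hx y hy hxy =>
      ⟨fun hX => hXcl x hX y hxy (hfin y (hL hy)), fun hX => hXcl y hX x hxy.symm (hfin x (hL hx))⟩]
    have hpf : ∀ Y, (diffSet π₂ (patch Y π₂ π')).Finite := fun Y => by
      rw [diffSet_patch]; exact hf.subset Set.inter_subset_left
    refine add_nonneg (hgood.minimal _ (hpf X) ?_) ?_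
    · rw [diffSet_patch]
      rintro x ⟨hx, hxX⟩
      exact ⟨hL hx, fun h' => h' ⟨hxX, (hsub hx).2⟩⟩
    set F := diffSet π₂ π' \ X with hF
    have hFs : s ∉ F := fun h' => hL h'.1 hs
    have hFπ : ∀ x ∈ F, π₂ x = π x := fun x hx =>
      heq2 x hx.2 (by rintro rfl; exact hFs hx)
    have hσ : diffSet π (patch F π π') ⊆ F := by
      rw [diffSet_patch]; exact Set.inter_subset_right
    have hσf : (diffSet π (patch F π π')).Finite := hf.subset (hσ.trans Set.sdiff_subset)
    have hσL : diffSet π (patch F π π') ⊆ (infVerts G)ᶜ \ insert s A := by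
      intro x hx
      have hxF := hσ hx
      refine ⟨hL hxF.1, ?_⟩
      rintro (rfl | h')
      exacts [hFs hxF, (hsub hxF.1).2 h']
    refine (h.minimal _ hσf hσL).trans (energyDiff_mono hσf (hσL.trans Set.sdiff_subset) (hpf _)
      (by rw [diffSet_patch]; exact Set.inter_subset_left.trans hL) ?_)
    have hτ : ∀ x ∉ F, patch Xᶜ π₂ π' x = π₂ x := by
      intro x hx
      by_cases hxX : x ∈ X
      · exact patch_notMem (by simpa using hxX)
      · rw [patch_mem (by simpa using hxX)]
        exact (notMem_diffSet.1 fun h' => hx ⟨h', hxX⟩).symm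
    have hτF : ∀ x ∈ F, patch Xᶜ π₂ π' x = π' x := fun x hx => patch_mem hx.2
    have key : ∀ x ∈ F, ∀ y, G.Adj x y →
        pairEnergy G (patch F π π') (x, y) - pairEnergy G π (x, y) ≤
        pairEnergy G (patch Xᶜ π₂ π') (x, y) - pairEnergy G π₂ (x, y) := by
      intro x hx y hxy
      have hdx := hfin x (hL hx.1)
      -- Since `x` is outside `X`, it was a friend of `s` and is now an opponent, so the energy of
      -- this pair cannot fall further.
      by_cases hys : y = s
      · subst hys
        have hex : π x = π y := by
          by_contra hne
          exact hx.2 (hDX x ⟨hxy.symm, hne⟩ hdx)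
        rw [pairEnergy_of_eq (π := π) hxy hex, pairEnergy_of_ne (π := π₂) hxy
          (by rw [hFπ x hx, heq' y hsX, hex]; simp [flip])]
        have h1 := pairEnergy_le_one (G := G) (patch F π π') (x, y)
        have h2 := neg_one_le_pairEnergy (G := G) (patch Xᶜ π₂ π') (x, y)
        linarith
      · have hyX : y ∉ X := fun hyX => hx.2 (hXcl y hyX x hxy.symm hdx)
        rw [pairEnergy_congr (π := π₂) (π' := π) (hFπ x hx) (heq2 y hyX hys),
          pairEnergy_congr (π := patch F π π') (π' := patch Xᶜ π₂ π')
            ((patch_mem hx).trans (hτF x hx).symm)]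
        by_cases hyF : y ∈ F
        · exact (patch_mem hyF).trans (hτF y hyF).symm
        · rw [patch_notMem hyF, hτ y hyF, heq2 y hyX hys]
    rintro ⟨x, y⟩
    by_cases hxy : G.Adj x y
    · by_cases hx : x ∈ F
      · exact key x hx y hxy
      by_cases hy : y ∈ F
      · simp only [pairEnergy_swap _ x y]
        exact key y hy x hxy.symm
      rw [pairEnergy_congr (π := patch F π π') (π' := π) (patch_notMem hx) (patch_notMem hy),
        pairEnergy_congr (hτ x hx) (hτ y hy)]
      simp
    · simp [pairEnergy_of_not_adj _ hxy]

end Release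

/-- A finite set of vertices that have to be prescribed can be dispensed with. -/
theorem ExtendableAbove.of_finite {B : Set V} (hB : B.Finite) (h : ExtendableAbove G B) :
    ExtendableAbove G ∅ := by
  classical
  intro W _ ρ
  have release : ∀ n : ℕ, ∀ R : Finset V, R.card = n → Disjoint (R : Set V) W →
      (∀ t ∈ B, t ∉ W → t ∉ R → ∀ r ∈ R, #(G.neighborSet r) ≤ #(G.neighborSet t)) →
      ∀ π, StronglyHappyOff G (W ∪ R) π →
        ∃ π', (∀ x ∈ W, π' x = π x) ∧ StronglyHappyOff G W π' := by
    intro n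
    induction n with
    | zero =>
      intro R hR _ _ π hπ
      rw [Finset.card_eq_zero] at hR
      subst hR
      exact ⟨π, fun _ _ => rfl, by simpa using hπ⟩
    | succ n ih =>
      intro R hR hRW hdeg π hπ
      -- Choosing the largest degree ensures that everything in `B` released earlier has degree at
      -- least that of `s`.
      obtain ⟨s, hsR, hmax⟩ := R.exists_max_image (fun r => #(G.neighborSet r))
        (Finset.card_pos.1 (by omega))
      have hsW : s ∉ W := fun hsW => (Set.disjoint_left.1 hRW) hsR hsW
      have hins : W ∪ R = insert s (W ∪ (R.erase s : Finset V)) := by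
        ext x
        by_cases hx : x = s <;> simp [hx, hsR]
      rw [hins] at hπ
      have hsA : s ∉ W ∪ ((R.erase s : Finset V) : Set V) := by simp [hsW]
      have hdeg' : ∀ t ∈ B, t ∉ W ∪ ((R.erase s : Finset V) : Set V) →
          #(G.neighborSet s) ≤ #(G.neighborSet t) := by
        intro t ht htA
        by_cases hts : t = s
        · rw [hts]
        · refine hdeg t ht (fun h' => htA (Or.inl h')) (fun h' => htA (Or.inr ?_)) s hsR
          simpa [hts] using h'
      obtain ⟨π₁, h1, h2⟩ : ∃ π', (∀ x ∈ W ∪ ((R.erase s : Finset V) : Set V), π' x = π x) ∧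
          StronglyHappyOff G (W ∪ ((R.erase s : Finset V) : Set V)) π' := by
        by_cases hs : s ∈ infVerts G
        · by_cases hu : Happy G π s
          · exact ⟨π, fun _ _ => rfl, hπ.of_happy hs hu⟩
          · by_cases ho : (opponents G π s).Finite
            · exact hπ.release_of_finite_opponents hs hsA hu ho
            · exact hπ.release_of_infinite_opponents h hs hsA hdeg' hu ho
        · exact hπ.release_of_finite_degree hs
      obtain ⟨π₂, h3, h4⟩ := ih (R.erase s) (by rw [Finset.card_erase_of_mem hsR]; omega)
        (hRW.mono_left (by simp)) (by
          intro t ht htW htR r hr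
          by_cases hts : t = s
          · rw [hts]; exact hmax r (Finset.mem_of_mem_erase hr)
          · exact hdeg t ht htW (fun h' => htR (by simp [hts, h'])) r (Finset.mem_of_mem_erase hr))
        π₁ h2
      exact ⟨π₂, fun x hx => (h3 x hx).trans (h1 x (Or.inl hx)), h4⟩
  have hfin : (B \ W).Finite := hB.subset Set.sdiff_subset
  obtain ⟨π, hπρ, hπ⟩ := h (W ∪ B) Set.subset_union_right ρ
  obtain ⟨π', h1, h2⟩ := release _ hfin.toFinset rfl (by simpa using Set.disjoint_sdiff_left)
    (by intro t ht htW htR; exact (htR (by simp [ht, htW])).elim) π (by simpa using hπ)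
  exact ⟨π', fun x hx => (h1 x hx).trans (hπρ x (Or.inl hx)), h2⟩

/-! ### Countable graphs -/

/-- A countable graph is extendable above any set containing all vertices of infinite degree that
have only finitely many neighbours of infinite degree. -/
theorem extendableAbove_of_countable [Countable V] {B : Set V}
    (hB : ∀ x ∈ infVerts G, x ∉ B → (G.neighborSet x ∩ infVerts G).Infinite) :
    ExtendableAbove G B := by
  intro W hBW ρ
  have hsub : infVerts G ⊆ infVerts G \ W ∪ W := fun x hx => by
    by_cases h : x ∈ W
    exacts [Or.inr h, Or.inl ⟨hx, h⟩]
  obtain ⟨π₀, h1, h2⟩ := exists_infinite_opponents (G := G) W (infVerts G \ W)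
    (fun x hx => (hB x hx.1 fun h => hx.2 (hBW h)).mono (Set.inter_subset_inter_right _ hsub))
    Set.disjoint_sdiff_right ρ
  -- Minimising recolours only free vertices of finite degree, so the infinitely many opponents in
  -- `infVerts G ∪ W` survive.
  obtain ⟨π, h3, h4⟩ := exists_energyMinimal (G := G) (L := (infVerts G)ᶜ \ W) Set.sdiff_subset π₀
  refine ⟨π, fun x hx => (h3 x fun h => h.2 hx).trans (h1 x hx), fun x hx hxW => ?_, h4⟩
  rw [happy_iff_of_mem_infVerts hx]
  have hinf : (opponents G π x).Infinite := by
    refine (h2 x ⟨hx, hxW⟩).mono ?_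
    rintro y ⟨⟨hy, hne⟩, hyW⟩
    refine ⟨hy, ?_⟩
    rw [h3 x fun h => h.1 hx, h3 y fun h => hyW.elim (fun h' => h.1 h'.1) h.2]
    exact hne
  exact mk_le_aleph0.trans (Cardinal.infinite_iff.1 (Set.infinite_coe_iff.2 hinf))

/-! ### Gluing along a separator -/

section Induce

variable {T : Set V}

theorem image_friends_induce (π : V → Bool) {x : T} (hx : G.neighborSet x ⊆ T) :
    Subtype.val '' friends (G.induce T) (fun v => π v) x = friends G π x := by
  ext y
  constructor
  · rintro ⟨y, hy, rfl⟩
    exact hy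
  · exact fun hy => ⟨⟨y, hx hy.1⟩, hy, rfl⟩

theorem image_opponents_induce (π : V → Bool) {x : T} (hx : G.neighborSet x ⊆ T) :
    Subtype.val '' opponents (G.induce T) (fun v => π v) x = opponents G π x := by
  ext y
  constructor
  · rintro ⟨y, hy, rfl⟩
    exact hy
  · exact fun hy => ⟨⟨y, hx hy.1⟩, hy, rfl⟩

theorem happy_induce_iff (π : V → Bool) {x : T} (hx : G.neighborSet x ⊆ T) :
    Happy (G.induce T) (fun v => π v) x ↔ Happy G π x := by
  unfold Happy
  rw [← image_friends_induce π hx, ← image_opponents_induce π hx,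
    mk_image_eq Subtype.val_injective, mk_image_eq Subtype.val_injective]

theorem mem_infVerts_induce_iff {x : T} (hx : G.neighborSet x ⊆ T) :
    x ∈ infVerts (G.induce T) ↔ (x : V) ∈ infVerts G := by
  have : Subtype.val '' (G.induce T).neighborSet x = G.neighborSet x := by
    ext y
    constructor
    · rintro ⟨y, hy, rfl⟩
      exact hy
    · exact fun hy => ⟨⟨y, hx hy⟩, hy, rfl⟩
  change (_ : Set _).Infinite ↔ (_ : Set _).Infinite
  rw [← this, Set.infinite_image_iff Subtype.val_injective.injOn]

/-- Every pair contributing to the difference meets the changed set and hence lies in `T × T`. -/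
theorem energyDiff_induce {π π' : V → Bool} (hT : ∀ x ∈ diffSet π π', x ∈ T ∧ G.neighborSet x ⊆ T) :
    energyDiff (G.induce T) (fun v => π v) (fun v => π' v) = energyDiff G π π' := by
  let g : T × T → V × V := fun p => (p.1, p.2)
  have hg : Function.Injective g := by
    rintro ⟨a, b⟩ ⟨c, d⟩ h
    simpa [g, Subtype.ext_iff] using h
  unfold energyDiff
  rw [← finsum_mem_univ (fun p : V × V => _), ← finsum_mem_inter_support_eq' _ (Set.range g) Set.univ,
    finsum_mem_range hg]
  · rfl
  · intro p hp
    simp only [Set.mem_univ, iff_true]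
    obtain ⟨hadj, h | h⟩ := support_subset_touching _ _ hp
    · exact ⟨(⟨p.1, (hT _ h).1⟩, ⟨p.2, (hT _ h).2 hadj⟩), rfl⟩
    · exact ⟨(⟨p.1, (hT _ h).2 hadj.symm⟩, ⟨p.2, (hT _ h).1⟩), rfl⟩

end Induce

/-- If the classes of `c` separate `G - S`, then `G` is extendable above `S` provided that the
graphs induced by `S` and any one of the classes are extendable. -/
theorem extendableAbove_of_parts {ι : Type*} (S : Set V) (c : V → ι)
    (hc : ∀ x ∉ S, ∀ y ∉ S, G.Adj x y → c x = c y)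
    (h : ∀ x ∉ S, ExtendableAbove (G.induce {y | y ∈ S ∨ c y = c x}) ∅) :
    ExtendableAbove G S := by
  classical
  intro W hSW ρ
  have hN : ∀ x ∉ S, G.neighborSet x ⊆ {y | y ∈ S ∨ c y = c x} := by
    intro x hx y hy
    by_cases hyS : y ∈ S
    exacts [Or.inl hyS, Or.inr (hc x hx y hyS hy).symm]
  have hex : ∀ i, ∃ σ : V → Bool, (∃ x ∉ S, c x = i) →
      (∀ v ∈ W, v ∈ S ∨ c v = i → σ v = ρ v) ∧
      StronglyHappyOff (G.induce {y | y ∈ S ∨ c y = i}) (Subtype.val ⁻¹' W) (fun v => σ v) := by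
    intro i
    by_cases hi : ∃ x ∉ S, c x = i
    · obtain ⟨x, hx, rfl⟩ := hi
      obtain ⟨τ, h1, h2⟩ := h x hx (Subtype.val ⁻¹' W) (Set.empty_subset _) fun v => ρ v
      refine ⟨fun v => if hv : v ∈ {y | y ∈ S ∨ c y = c x} then τ ⟨v, hv⟩ else false,
        fun _ => ⟨fun v hv hv' => ?_, ?_⟩⟩
      · have hv'' : v ∈ {y | y ∈ S ∨ c y = c x} := hv'
        simpa only [hv'', ↓reduceDIte] using h1 ⟨v, hv''⟩ hv
      · convert h2 using 2 with v
        simp only [v.2, ↓reduceDIte]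
    · exact ⟨fun _ => false, fun h' => (hi h').elim⟩
  choose σ hσ using hex
  let π : V → Bool := fun v => if v ∈ S then ρ v else σ (c v) v
  have hπ : ∀ x ∉ S, ∀ v ∈ {y | y ∈ S ∨ c y = c x}, π v = σ (c x) v := by
    intro x hx v hv
    by_cases hvS : v ∈ S
    · simp only [π, hvS, if_true]
      exact ((hσ _ ⟨x, hx, rfl⟩).1 v (hSW hvS) (Or.inl hvS)).symm
    · simp only [π, hvS, if_false]
      rw [hv.resolve_left hvS]
  have hgood : ∀ x ∉ S, StronglyHappyOff (G.induce {y | y ∈ S ∨ c y = c x}) (Subtype.val ⁻¹' W)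
      (fun v => π v) := by
    intro x hx
    convert (hσ _ ⟨x, hx, rfl⟩).2 using 2 with v
    exact hπ x hx v v.2
  refine ⟨π, fun x hx => ?_, fun x hx hxW => ?_, ?_⟩
  · by_cases hxS : x ∈ S
    · simp [π, hxS]
    · simp only [π, hxS, if_false]
      exact (hσ _ ⟨x, hxS, rfl⟩).1 x hx (Or.inr rfl)
  · have hxS : x ∉ S := fun h' => hxW (hSW h')
    have := (hgood x hxS).happy ⟨x, Or.inr rfl⟩ ((mem_infVerts_induce_iff (hN x hxS)).2 hx) hxW
    exact (happy_induce_iff π (x := ⟨x, Or.inr rfl⟩) (hN x hxS)).1 this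
  -- A finite change is peeled off class by class: changed vertices of different classes are
  -- non-adjacent, so the energy splits, and each class is handled in its own part.
  · have main : ∀ n : ℕ, ∀ π', (diffSet π π').Finite → diffSet π π' ⊆ (infVerts G)ᶜ \ W →
        (diffSet π π').ncard = n → 0 ≤ energyDiff G π π' := by
      intro n
      induction n using Nat.strong_induction_on with
      | _ n ih =>
        intro π' hf hsub hn
        rcases (diffSet π π').eq_empty_or_nonempty with he | ⟨x, hx⟩
        · have : π = π' := by
            ext v
            by_contra hv
            exact (he ▸ (show v ∈ diffSet π π' from fun h' => hv (by rw [h'])) : v ∈ (∅ : Set V))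
          rw [this, energyDiff_self]
        have hdS : ∀ v ∈ diffSet π π', v ∉ S := fun v hv hvS => (hsub hv).2 (hSW hvS)
        rw [energyDiff_split hf (hsub.trans Set.sdiff_subset) (X := {v | c v = c x})
          fun a ha b hb hab => by
            rw [Set.mem_ofPred_eq, Set.mem_ofPred_eq, hc a (hdS a ha) b (hdS b hb) hab]]
        refine add_nonneg ?_ (ih _ ?_ _ ?_ ?_ rfl)
        · set π₁ := patch {v | c v = c x} π π' with hπ₁
          have hd : diffSet π π₁ = diffSet π π' ∩ {v | c v = c x} := diffSet_patch _ _ _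
          have hd' : ∀ v ∈ diffSet π π₁, v ∉ S ∧ c v = c x := fun v hv => by
            rw [hd] at hv
            exact ⟨hdS v hv.1, hv.2⟩
          have hN' : ∀ v ∈ diffSet π π₁, G.neighborSet v ⊆ {y | y ∈ S ∨ c y = c x} := by
            intro v hv
            rw [← (hd' v hv).2]
            exact hN v (hd' v hv).1
          rw [← energyDiff_induce (T := {y | y ∈ S ∨ c y = c x})
            fun v hv => ⟨Or.inr (hd' v hv).2, hN' v hv⟩]
          refine (hgood x (hdS x hx)).minimal _ ?_ ?_
          · have : diffSet (fun v : {y | y ∈ S ∨ c y = c x} => π v) (fun v => π₁ v) =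
                Subtype.val ⁻¹' diffSet π π₁ := rfl
            rw [this]
            exact (hf.subset (hd ▸ Set.inter_subset_left)).preimage Subtype.val_injective.injOn
          · intro v hv
            have hv' : (v : V) ∈ diffSet π π₁ := hv
            have hv'' := hsub (hd ▸ hv' : (v : V) ∈ diffSet π π' ∩ _).1
            exact ⟨fun hi => hv''.1 ((mem_infVerts_induce_iff (hN' v hv')).1 hi), hv''.2⟩
        · rw [← hn, diffSet_patch]
          refine Set.ncard_lt_ncard ⟨Set.inter_subset_left, fun hs => ?_⟩ hf
          exact (hs hx).2 rfl
        · rw [diffSet_patch]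
          exact hf.subset Set.inter_subset_left
        · rw [diffSet_patch]
          exact Set.inter_subset_left.trans hsub
    exact fun π' hf hsub => main _ π' hf hsub rfl

/-! ### Induction on the level -/

theorem map_mem_infVerts {V' : Type u} {G' : SimpleGraph V'} (f : G' ↪g G) {x : V'}
    (hx : x ∈ infVerts G') : f x ∈ infVerts G := by
  refine (hx.image f.injective.injOn).mono ?_
  rintro _ ⟨y, hy, rfl⟩
  exact f.map_adj_iff.2 hy

/-- A graph obtained by adding finitely many vertices to a graph in the closure of `classW` is
extendable. -/
theorem extendableAbove_of_level (μ : Ordinal.{u}) : ∀ {V' V : Type u} {G' : SimpleGraph V'}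
    {G : SimpleGraph V} (f : G' ↪g G), (Set.range f)ᶜ.Finite → classW.level μ V' G' →
    ExtendableAbove G ∅ := by
  classical
  induction μ using WellFoundedLT.induction with
  | _ μ ih =>
  intro V' V G' G f hf hG
  by_cases hμ : μ = 0
  · subst hμ
    rw [GraphClass.level_zero] at hG
    obtain ⟨hcount, hstar⟩ := hG
    have : Countable V := by
      rw [← Set.countable_univ_iff, ← Set.union_compl_self (Set.range f)]
      exact (Set.countable_range f).union hf.countable
    refine ExtendableAbove.of_finite (B := (Set.range f)ᶜ ∪ f '' starVerts G')
      (hf.union (hstar.image f)) (extendableAbove_of_countable fun x hx hxB => ?_)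
    obtain ⟨x, rfl⟩ : x ∈ Set.range f := by
      by_contra h; exact hxB (Or.inl h)
    have hx' : x ∈ infVerts G' := by
      intro hfin
      refine hx (((hfin.image f).union hf).subset fun y hy => ?_)
      by_cases hyr : y ∈ Set.range f
      · obtain ⟨y, rfl⟩ := hyr
        exact Or.inl ⟨y, f.map_adj_iff.1 hy, rfl⟩
      · exact Or.inr hyr
    have hinf : (G'.neighborSet x ∩ infVerts G').Infinite := fun hfin =>
      hxB (Or.inr ⟨x, ⟨hx', hfin⟩, rfl⟩)
    refine (hinf.image f.injective.injOn).mono ?_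
    rintro _ ⟨y, ⟨hy, hy'⟩, rfl⟩
    exact ⟨f.map_adj_iff.2 hy, map_mem_infVerts f hy'⟩
  · rw [GraphClass.level_of_ne_zero _ hμ] at hG
    obtain ⟨S', hS', hC⟩ := hG
    set S : Set V := (Set.range f)ᶜ ∪ f '' S' with hS
    have hSfin : S.Finite := hf.union (hS'.image f)
    have hlift : ∀ x ∉ S, ∃ x' : ↥S'ᶜ, f x' = x := by
      intro x hx
      obtain ⟨x', rfl⟩ : x ∈ Set.range f := by
        by_contra h; exact hx (Or.inl h)
      exact ⟨⟨x', fun h => hx (Or.inr ⟨x', h, rfl⟩)⟩, rfl⟩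
    -- The value `none` is taken exactly on `S`; other vertices are labelled by their component.
    let c : V → Option (G'.induce S'ᶜ).ConnectedComponent := fun v =>
      if h : ∃ x' : ↥S'ᶜ, f x' = v then some (SimpleGraph.connectedComponentMk _ h.choose) else none
    have hcf : ∀ x' : ↥S'ᶜ, c (f x') = some (SimpleGraph.connectedComponentMk _ x') := by
      intro x'
      have h : ∃ y' : ↥S'ᶜ, f y' = f x' := ⟨x', rfl⟩
      have he : h.choose = x' := Subtype.ext (f.injective h.choose_spec)
      refine (dif_pos h).trans ?_
      rw [he]
    refine ExtendableAbove.of_finite hSfin (extendableAbove_of_parts S c ?_ ?_)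
    · intro x hx y hy hxy
      obtain ⟨x', rfl⟩ := hlift x hx
      obtain ⟨y', rfl⟩ := hlift y hy
      rw [hcf, hcf, Option.some_inj, SimpleGraph.ConnectedComponent.eq]
      have : (G'.induce S'ᶜ).Adj x' y' := f.map_adj_iff.1 hxy
      exact this.reachable
    · intro x hx
      obtain ⟨x', rfl⟩ := hlift x hx
      obtain ⟨ν, hν, hlevel⟩ := hC (SimpleGraph.connectedComponentMk _ x')
      have hmem : ∀ z : (SimpleGraph.connectedComponentMk (G'.induce S'ᶜ) x').supp,
          c (f z.1) = c (f x') := by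
        intro z
        rw [hcf, hcf]
        exact congrArg some z.2
      let g : ((G'.induce S'ᶜ).induce (SimpleGraph.connectedComponentMk _ x').supp) ↪g
          G.induce {y | y ∈ S ∨ c y = c (f x')} :=
        { toFun := fun z => ⟨f z.1, Or.inr (hmem z)⟩
          inj' := fun z w h => Subtype.ext (Subtype.ext (f.injective (congrArg Subtype.val h)))
          map_rel_iff' := f.map_adj_iff }
      refine ih ν hν g ?_ hlevel
      refine (hSfin.preimage (f := Subtype.val) Subtype.val_injective.injOn).subset ?_
      rintro ⟨y, hy⟩ hyg
      by_contra hyS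
      obtain ⟨y', rfl⟩ := hlift y hyS
      have hcy := hy.resolve_left hyS
      rw [hcf, hcf, Option.some_inj] at hcy
      exact hyg ⟨⟨y', hcy⟩, rfl⟩

end UnfriendlyPartition

theorem mainTheorem3 {V : Type u} (G : SimpleGraph V)
    (hG : UnfriendlyPartition.classW.closure V G) :
    UnfriendlyPartition.PrePartitionable G ∧
      ∃ π : V → Bool, UnfriendlyPartition.Unfriendly G π := by
  obtain ⟨μ, hμ⟩ := hG
  have hr : Set.range (SimpleGraph.Embedding.refl (G := G)) = Set.univ := Set.range_id
  have h : UnfriendlyPartition.PrePartitionable G :=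
    (UnfriendlyPartition.extendableAbove_of_level μ (SimpleGraph.Embedding.refl (G := G))
      (by rw [hr]; simp) hμ).prePartitionable
  refine ⟨h, ?_⟩
  obtain ⟨π, -, hπ⟩ := h ∅ fun _ => false
  exact ⟨π, fun x => hπ x (Set.notMem_empty x)⟩
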